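/- Let $d\ge 1$ and equip $\mathbb{R}^d$ with the Euclidean norm. For $S\subset\mathbb{R}^d$ and $y\in\mathbb{R}^d$ put $d(y,S)=\inf_{x\in S}\|y-x\|$, let $\mathrm{Unp}(S)$ be the set of points of $\mathbb{R}^d$ with a unique nearest point in $S$, and let $$\mathrm{reach}(S)=\inf_{x\in S}\ \sup\{r>0:\ \mathring{\mathcal B}(x,r)\subset \mathrm{Unp}(S)\}\in[0,\infty],$$ where $\mathring{\mathcal B}(x,r)$ and $\mathcal B(x,r)$ are the open and the closed ball. Let $\mathcal M\subset\mathbb{R}^d$ be a nonempty compact set with $\mathrm{reach}(\mathcal M)=R_0\in(0,\infty]$. Let $0<R_1<R_0$ be a real constant and let $Y_1,Y_2,\dots$ be independent random vectors with a common distribution $P_Y$ whose support is the parallel set $S=\{y\in\mathbb{R}^d: d(y,\mathcal M)\le R_1\}$. Suppose that $P_Y$ is absolutely continuous with respect to Lebesgue measure, with a density $f$ satisfying $f\ge f_0$ almost everywhere on $S$ for a constant $f_0>0$. Let $\omega_d$ be the Lebesgue measure of the closed unit ball, and let $\varepsilon_n=c(\log(n)/n)^{1/d}$ with a constant $c>(6/(f_0\omega_d))^{1/d}$.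 Put $\hat S_n=\bigcup_{i=1}^n\mathcal B(Y_i,\varepsilon_n)$, let $$I_{bb}=\{j\in\{1,\dots,n\}:\ \partial\mathcal B(Y_j,\varepsilon_n)\cap\partial\hat S_n\neq\emptyset\}$$ be the set of indices of the boundary balls, and let $$\hat R_n=\max_{1\le i\le n}\ \min_{j\in I_{bb}}\|Y_i-Y_j\|.$$ (i) If $\mathcal M$ has empty interior then, with probability one, $|\hat R_n-R_1|\le 2\varepsilon_n$ for all $n$ large enough. (ii) If $\mathcal M$ has nonempty interior then there exists a (deterministic) constant $C>0$ such that, with probability one, $|\hat R_n-R_1|>C$ for all $n$ large enough. -/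

import Mathlib

open MeasureTheory ProbabilityTheory Filter Topology
open scoped ENNReal

noncomputable section

namespace ParallelModel

/-- `Unp(S)`: the points of the space with a unique metric projection on `S`. -/
def unp {d : ℕ} (S : Set (EuclideanSpace ℝ (Fin d))) : Set (EuclideanSpace ℝ (Fin d)) :=
  {x | ∃! p, p ∈ S ∧ dist x p = Metric.infDist x S}

/-- `reach(S, x) = sup {r > 0 : the open ball B(x, r) is contained in Unp(S)}`, in `[0, ∞]`. -/
def reachAt {d : ℕ} (S : Set (EuclideanSpace ℝ (Fin d))) (x : EuclideanSpace ℝ (Fin d)) : ℝ≥0∞ :=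
  ⨆ (r : ℝ) (_ : 0 < r) (_ : Metric.ball x r ⊆ unp S), ENNReal.ofReal r

/-- `reach(S) = inf {reach(S, x) : x ∈ S}`, in `[0, ∞]` (convex sets have infinite reach). -/
def reach {d : ℕ} (S : Set (EuclideanSpace ℝ (Fin d))) : ℝ≥0∞ :=
  ⨅ x ∈ S, reachAt S x

/-- The offset (Devroye-Wise) estimator: the union of the closed balls of radius `r` centred at
the sample points. -/
def offset {d n : ℕ} (X : Fin n → EuclideanSpace ℝ (Fin d)) (r : ℝ) :
    Set (EuclideanSpace ℝ (Fin d)) :=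
  ⋃ i, Metric.closedBall (X i) r

/-- The set of the indices `i` for which the closed ball of centre `X i` and radius `r` is a
boundary ball: some point of its boundary belongs to the boundary of the offset estimator. -/
def boundaryIndices {d n : ℕ} (X : Fin n → EuclideanSpace ℝ (Fin d)) (r : ℝ) : Set (Fin n) :=
  {i | ∃ y ∈ frontier (Metric.closedBall (X i) r), y ∈ frontier (offset X r)}

/-- The maximum over the sample points of the minimal distance to the centres of the boundary
balls. Both index sets are finite, and nonempty as soon as `0 < n`, `0 < d` and `0 < r`, so the
supremum and the infimum are a maximum and a minimum. -/
def noiseEstimator {d n : ℕ} (X : Fin n → EuclideanSpace ℝ (Fin d)) (r : ℝ) : ℝ :=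
  ⨆ i : Fin n, ⨅ j : boundaryIndices X r, dist (X i) (X j)

/-- `ω_d`, the Lebesgue measure of the closed unit ball of `ℝ^d`. -/
def unitBallVolume (d : ℕ) : ℝ :=
  (volume (Metric.closedBall (0 : EuclideanSpace ℝ (Fin d)) 1)).toReal

/-- The radius `ε_n = c (log n / n)^{1/d}`. -/
def radius (d : ℕ) (c : ℝ) (n : ℕ) : ℝ :=
  c * (Real.log n / n) ^ (1 / (d : ℝ))

end ParallelModel

end

/-! Both claims reduce to deterministic geometry once the sample balls cover the parallel set `S`,
which almost surely holds for all large `n`. For coverage, `S` is a union of balls of radius `R₁`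
centred on `M`, so a small ball centred in `S` meets `S` in roughly half a ball or more; a net, a
union bound and Borel–Cantelli finish (`ae_eventually_subset_offset`).

Under coverage, centres of boundary balls lie at distance at least `R₁ - r` from `M`. If a closed
ball of radius `ρ` around `m` lies in `M`, a sample point near `m` is thus at least `R₁ + ρ - 2r`
from all of them (`add_sub_le_noiseEstimator`). Taking `ρ = 0` gives the lower bound in (i); `ρ > 0`
gives (ii).

For the upper bound in (i), empty interior lets any sample point be pushed off `M`. Unique
projections then let the distance to `M` grow at rate almost 1 until it exceeds `R₁ + r`, outside
the offset (`exists_lt_infDist_dist_lt`). The segment to that point crosses the boundary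
(`noiseEstimator_le_add`). -/

namespace ParallelModel

/-! ### Climbing the distance function of a set of positive reach -/

section Distance

variable {E : Type*} [NormedAddCommGroup E] [InnerProductSpace ℝ E]

theorem mem_cthickening_iff_infDist_le {X : Type*} [PseudoMetricSpace X] {M : Set X}
    (hne : M.Nonempty) {R : ℝ} (hR : 0 ≤ R) {x : X} :
    x ∈ Metric.cthickening R M ↔ Metric.infDist x M ≤ R := by
  rw [Metric.mem_cthickening_iff, Metric.infDist,
    ENNReal.le_ofReal_iff_toReal_le (Metric.infEDist_ne_top hne) hR]

/-- Moving straight away from the unique projection, points of `M` in nearly that direction recede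
at rate at least `1 - η`, and by compactness all others start farther away by a fixed gap. -/
theorem add_mul_le_infDist_of_unique {M : Set E} (hM : IsCompact M) {x p : E} (hp : p ∈ M)
    (hx : 0 < Metric.infDist x M) (hpx : dist x p = Metric.infDist x M)
    (huniq : ∀ q ∈ M, dist x q = Metric.infDist x M → q = p)
    {η : ℝ} (hη : 0 < η) (hη1 : η < 1) :
    ∃ u : E, ‖u‖ = 1 ∧ ∃ γ > 0, ∀ h, 0 < h → h ≤ γ →
      Metric.infDist x M + (1 - η) * h ≤ Metric.infDist (x + h • u) M := by
  set D := Metric.infDist x M with hD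
  set u : E := D⁻¹ • (x - p) with hu
  have hnorm : ‖x - p‖ = D := by rw [← dist_eq_norm, hpx]
  have hu1 : ‖u‖ = 1 := by
    rw [hu, norm_smul, hnorm, norm_inv, Real.norm_of_nonneg hx.le, inv_mul_cancel₀ hx.ne']
  have hup : inner ℝ u (x - p) = D := by
    rw [hu, real_inner_smul_left, real_inner_self_eq_norm_sq, hnorm]
    field_simp
  set N : Set E := M ∩ {q | inner ℝ u (x - q) ≤ (1 - η) * D} with hN
  have hNc : IsCompact N := hM.inter_right (isClosed_le (by fun_prop) (by fun_prop))
  have hγ : ∃ γ > 0, ∀ q ∈ N, D + γ ≤ dist x q := by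
    rcases N.eq_empty_or_nonempty with hNe | hNe
    · exact ⟨1, one_pos, by simp [hNe]⟩
    · obtain ⟨q, hq, hqmin⟩ := hNc.exists_isMinOn hNe (f := fun q => dist x q) (by fun_prop)
      have h1 : D ≤ dist x q := Metric.infDist_le_dist_of_mem hq.1
      have h2 : D ≠ dist x q := by
        intro h
        have := huniq q hq.1 h.symm
        have h3 := hq.2
        rw [this, Set.mem_ofPred_eq, hup] at h3
        nlinarith
      exact ⟨dist x q - D, sub_pos.2 (lt_of_le_of_ne h1 h2), fun q' hq' => by
        have := hqmin hq'
        simp only [Set.mem_ofPred_eq] at this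
        linarith⟩
  obtain ⟨γ, hγ, hγN⟩ := hγ
  -- With `h ≤ γ / 2`, points of `N` remain at distance at least `D + γ - h ≥ D + h`.
  refine ⟨u, hu1, γ / 2, by positivity, fun h h0 hh => ?_⟩
  refine (Metric.le_infDist ⟨p, hp⟩).2 fun q hq => ?_
  by_cases hqN : q ∈ N
  · have h1 := hγN q hqN
    have h2 : dist x q ≤ dist x (x + h • u) + dist (x + h • u) q := dist_triangle _ _ _
    have h3 : dist x (x + h • u) = h := by
      rw [dist_self_add_right, norm_smul, hu1, Real.norm_of_nonneg h0.le, mul_one]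
    nlinarith
  · have h1 : (1 - η) * D < inner ℝ u (x - q) := by
      by_contra hcon
      exact hqN ⟨hq, not_lt.1 hcon⟩
    have h2 : D ≤ ‖x - q‖ := by
      rw [← dist_eq_norm]
      exact Metric.infDist_le_dist_of_mem hq
    have h3 : ‖x + h • u - q‖ ^ 2 = ‖x - q‖ ^ 2 + 2 * (h * inner ℝ u (x - q)) + h ^ 2 := by
      have : x + h • u - q = (x - q) + h • u := by abel
      rw [this, norm_add_sq_real, real_inner_smul_right, real_inner_comm, norm_smul, hu1,
        Real.norm_of_nonneg h0.le, mul_one]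
    rw [dist_eq_norm]
    refine abs_le_of_sq_le_sq' ?_ (norm_nonneg _) |>.2
    rw [h3]
    have h4 : h * ((1 - η) * D) ≤ h * inner ℝ u (x - q) := by gcongr
    have h5 : D ^ 2 ≤ ‖x - q‖ ^ 2 := by gcongr
    have h6 : ((1 - η) * h) ^ 2 ≤ h ^ 2 := by
      apply pow_le_pow_left₀ (by nlinarith)
      nlinarith
    nlinarith

/-- An Ekeland-type argument replaces the gradient flow: maximize the distance to `M` penalized by
`(1 - η) * dist x x₀`. A maximizer below level `R` could still climb at slope `1 - η / 2`, which
beats the penalty. -/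
theorem exists_infDist_eq_of_unique [ProperSpace E] {M : Set E} (hM : IsCompact M) {R : ℝ}
    (huniq : ∀ x, 0 < Metric.infDist x M → Metric.infDist x M < R →
      ∃! p, p ∈ M ∧ dist x p = Metric.infDist x M)
    {x₀ : E} (hx₀ : 0 < Metric.infDist x₀ M) (hx₀R : Metric.infDist x₀ M ≤ R)
    {η : ℝ} (hη : 0 < η) (hη1 : η < 1) :
    ∃ z, Metric.infDist z M = R ∧ (1 - η) * dist z x₀ ≤ R := by
  have hne : M.Nonempty := by
    by_contra h
    simp [Set.not_nonempty_iff_eq_empty.1 h] at hx₀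
  have hK : IsCompact {x | Metric.infDist x M ≤ R} := by
    refine (hM.cthickening (r := R)).of_isClosed_subset
      (isClosed_le (Metric.continuous_infDist_pt M) continuous_const) fun x hx => ?_
    exact (mem_cthickening_iff_infDist_le hne (hx₀.le.trans hx₀R)).2 hx
  obtain ⟨z, hz, hmax⟩ := hK.exists_isMaxOn ⟨x₀, hx₀R⟩
    (f := fun x => Metric.infDist x M - (1 - η) * dist x x₀)
    (Continuous.continuousOn (by
      have := Metric.continuous_infDist_pt M
      fun_prop))
  have h0 := hmax (show x₀ ∈ _ from hx₀R)
  simp only [Set.mem_ofPred_eq, dist_self, mul_zero, sub_zero] at h0 hz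
  have hd : 0 ≤ (1 - η) * dist z x₀ := mul_nonneg (by linarith) dist_nonneg
  refine ⟨z, ?_, by linarith⟩
  by_contra hne'
  have hlt := lt_of_le_of_ne hz hne'
  have hpos : 0 < Metric.infDist z M := by linarith
  obtain ⟨p, ⟨hp, hpz⟩, hpu⟩ := huniq z hpos hlt
  obtain ⟨u, hu, γ, hγ, hγu⟩ := add_mul_le_infDist_of_unique hM hp hpos hpz
    (fun q hq hqd => hpu q ⟨hq, hqd⟩) (half_pos hη) (by linarith)
  set h := min γ (R - Metric.infDist z M) with hh
  have hh0 : 0 < h := lt_min hγ (by linarith)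
  have hinc := hγu h hh0 (min_le_left _ _)
  have hdist : dist (z + h • u) z = h := by
    rw [dist_self_add_left, norm_smul, hu, Real.norm_of_nonneg hh0.le, mul_one]
  have hle : Metric.infDist (z + h • u) M ≤ R := by
    have h1 := Metric.infDist_le_infDist_add_dist (s := M) (x := z + h • u) (y := z)
    have h2 : h ≤ R - Metric.infDist z M := min_le_right _ _
    linarith
  have h1 := hmax (show z + h • u ∈ _ from hle)
  simp only [Set.mem_ofPred_eq] at h1
  have h2 := dist_triangle (z + h • u) z x₀
  rw [hdist] at h2
  have h3 : (1 - η) * dist (z + h • u) x₀ ≤ (1 - η) * (h + dist z x₀) :=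
    mul_le_mul_of_nonneg_left h2 (by linarith)
  nlinarith

theorem exists_lt_infDist_dist_lt [ProperSpace E] {M : Set E} (hM : IsCompact M)
    (hint : interior M = ∅) {R : ℝ}
    (huniq : ∀ x, 0 < Metric.infDist x M → Metric.infDist x M < R →
      ∃! p, p ∈ M ∧ dist x p = Metric.infDist x M)
    {y : E} (hne : M.Nonempty) {a θ : ℝ} (ha : 0 < a) (hya : Metric.infDist y M ≤ a)
    (haR : a < R) (hθ : 0 < θ) :
    ∃ z, a < Metric.infDist z M ∧ dist z y < a + θ := by
  set b := min R (a + θ / 4) with hb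
  have hab : a < b := lt_min haR (by linarith)
  have hbθ : b ≤ a + θ / 4 := min_le_right _ _
  have hden : Dense Mᶜ := interior_eq_empty_iff_dense_compl.1 hint
  obtain ⟨x₀, hx₀M, hx₀⟩ := hden.exists_dist_lt y (ε := min (θ / 4) (b - a))
    (lt_min (by linarith) (by linarith))
  have hx₀1 := hx₀.trans_le (min_le_left _ _)
  have hx₀2 := hx₀.trans_le (min_le_right _ _)
  have hpos : 0 < Metric.infDist x₀ M := (hM.isClosed.notMem_iff_infDist_pos hne).1 hx₀M
  have hle : Metric.infDist x₀ M ≤ b := by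
    have := Metric.infDist_le_infDist_add_dist (s := M) (x := x₀) (y := y)
    rw [dist_comm] at this
    linarith
  -- Chosen so that `(1 - η) * dist z x₀ ≤ b` reads `dist z x₀ ≤ b + θ / 4`.
  set η := (θ / 4) / (b + θ / 4) with hη
  have hb0 : 0 < b := ha.trans hab
  obtain ⟨z, hz, hzd⟩ := exists_infDist_eq_of_unique hM (R := b)
    (fun x h1 h2 => huniq x h1 (h2.trans_le (min_le_left _ _))) hpos hle (η := η)
    (by positivity) (by rw [hη, div_lt_one (by positivity)]; linarith)
  have h1 : 1 - η = b / (b + θ / 4) := by rw [hη]; field_simp; ring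
  have h2 : dist z x₀ ≤ b + θ / 4 := by
    rw [h1, div_mul_eq_mul_div, div_le_iff₀ (by positivity)] at hzd
    exact le_of_mul_le_mul_left hzd hb0
  refine ⟨z, hz ▸ hab, ?_⟩
  have := dist_triangle z x₀ y
  rw [dist_comm x₀ y] at this
  linarith

end Distance

theorem mem_unp_of_infDist_lt_reach {d : ℕ} {M : Set (EuclideanSpace ℝ (Fin d))}
    (hM : IsCompact M) (hne : M.Nonempty) {x : EuclideanSpace ℝ (Fin d)}
    (hx : ENNReal.ofReal (Metric.infDist x M) < reach M) : x ∈ unp M := by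
  obtain ⟨p, hp, hpx⟩ := hM.exists_infDist_eq_dist hne x
  have h1 : ENNReal.ofReal (Metric.infDist x M) < reachAt M p :=
    hx.trans_le (iInf₂_le p hp)
  simp only [reachAt, lt_iSup_iff] at h1
  obtain ⟨r, hr, hsub, hlt⟩ := h1
  refine hsub ?_
  rw [Metric.mem_ball, ← hpx]
  exact (ENNReal.ofReal_lt_ofReal_iff hr).1 hlt

/-! ### Deterministic bounds on the estimator -/

section Offset

variable {d n : ℕ} {X : Fin n → EuclideanSpace ℝ (Fin d)} {r : ℝ}
  {M : Set (EuclideanSpace ℝ (Fin d))}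

theorem isClosed_offset (X : Fin n → EuclideanSpace ℝ (Fin d)) (r : ℝ) :
    IsClosed (offset X r) :=
  isClosed_iUnion_of_finite fun _ => Metric.isClosed_closedBall

/-- The segment from `X i` to `z` meets the frontier of the offset; a ball containing the crossing
point cannot have it in its interior, so it is a boundary ball. -/
theorem exists_mem_boundaryIndices_dist_le (hr : 0 ≤ r) (i : Fin n)
    {z : EuclideanSpace ℝ (Fin d)} (hz : z ∉ offset X r) :
    ∃ j ∈ boundaryIndices X r, dist (X i) (X j) ≤ dist (X i) z + r := by
  have hseg : IsPreconnected (segment ℝ (X i) z) := (convex_segment (X i) z).isPreconnected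
  have hi : X i ∈ offset X r := Set.mem_iUnion.2 ⟨i, Metric.mem_closedBall_self hr⟩
  have hfr : (segment ℝ (X i) z ∩ frontier (offset X r)).Nonempty := by
    by_contra hcon
    have hdisj : Disjoint (segment ℝ (X i) z) (frontier (offset X r)) :=
      Set.disjoint_iff_inter_eq_empty.2 (Set.not_nonempty_iff_eq_empty.1 hcon)
    have hsub : segment ℝ (X i) z ⊆ interior (offset X r) ∪ (offset X r)ᶜ := by
      intro w hw
      by_cases hwo : w ∈ offset X r
      · left
        by_contra hwi
        exact Set.disjoint_left.1 hdisj hw ⟨subset_closure hwo, hwi⟩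
      · exact Or.inr hwo
    obtain ⟨w, -, hw1, hw2⟩ := hseg _ _ isOpen_interior (isClosed_offset X r).isOpen_compl hsub
      ⟨X i, left_mem_segment ℝ _ _, (hsub (left_mem_segment ℝ _ _)).resolve_right (fun h => h hi)⟩
      ⟨z, right_mem_segment ℝ _ _, hz⟩
    exact hw2 (interior_subset hw1)
  obtain ⟨w, hw, hwf⟩ := hfr
  have hwo : w ∈ offset X r := (isClosed_offset X r).frontier_subset hwf
  obtain ⟨j, hj⟩ := Set.mem_iUnion.1 hwo
  refine ⟨j, ⟨w, ⟨subset_closure hj, fun hint => ?_⟩, hwf⟩, ?_⟩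
  · exact hwf.2 (interior_mono (Set.subset_iUnion (fun k => Metric.closedBall (X k) r) j) hint)
  · have h1 : dist (X i) w ≤ dist (X i) z := by
      have := dist_add_dist_of_mem_segment hw
      linarith [dist_nonneg (x := w) (y := z)]
    have h2 := dist_triangle (X i) w (X j)
    rw [Metric.mem_closedBall] at hj
    linarith

theorem boundaryIndices_nonempty (hd : 1 ≤ d) (hn : 0 < n) (hr : 0 ≤ r) :
    (boundaryIndices X r).Nonempty := by
  have : Nonempty (Fin d) := ⟨⟨0, hd⟩⟩
  have hb : Bornology.IsBounded (offset X r) :=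
    (Bornology.isBounded_iUnion.2 fun _ => Metric.isBounded_closedBall)
  have hne : offset X r ≠ Set.univ := by
    intro h
    rw [h] at hb
    exact NormedSpace.unbounded_univ ℝ (EuclideanSpace ℝ (Fin d)) hb
  obtain ⟨z, hz⟩ := (Set.ne_univ_iff_exists_notMem _).1 hne
  obtain ⟨j, hj, -⟩ := exists_mem_boundaryIndices_dist_le hr ⟨0, hn⟩ hz
  exact ⟨j, hj⟩

/-- A frontier point is a limit of uncovered points, all farther than `R` from `M`. -/
theorem le_infDist_of_mem_boundaryIndices {R : ℝ} (hr : 0 < r)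
    (hcov : ∀ y, Metric.infDist y M ≤ R → y ∈ offset X r)
    {j : Fin n} (hj : j ∈ boundaryIndices X r) : R - r ≤ Metric.infDist (X j) M := by
  obtain ⟨w, hw, hwo⟩ := hj
  rw [frontier_closedBall _ hr.ne', Metric.mem_sphere] at hw
  have hcl : IsClosed {y | R ≤ Metric.infDist y M} :=
    isClosed_le continuous_const (Metric.continuous_infDist_pt M)
  have hsub : (offset X r)ᶜ ⊆ {y | R ≤ Metric.infDist y M} := by
    intro y hy
    by_contra hlt
    exact hy (hcov y (not_le.1 hlt).le)
  have h1 : R ≤ Metric.infDist w M := by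
    rw [frontier_eq_closure_inter_closure] at hwo
    exact closure_minimal hsub hcl hwo.2
  have h2 := Metric.infDist_le_infDist_add_dist (s := M) (x := w) (y := X j)
  linarith

/-- The segment from `m` to `w` spends its first length `ρ` inside `M`. -/
theorem infDist_add_le_dist {m w : EuclideanSpace ℝ (Fin d)} {ρ : ℝ} (hρ : 0 ≤ ρ)
    (hball : Metric.closedBall m ρ ⊆ M) (hw : w ∉ M) :
    Metric.infDist w M + ρ ≤ dist m w := by
  have hlt : ρ < dist m w := by
    by_contra h
    exact hw (hball (by rw [Metric.mem_closedBall, dist_comm]; exact not_lt.1 h))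
  obtain ⟨q, hq1, hq2⟩ := exists_dist_le_le (x := m) (z := w) hρ
    (sub_nonneg.2 hlt.le) (by linarith : dist m w ≤ (dist m w - ρ) + ρ)
  have hqM : q ∈ M := hball (by rw [Metric.mem_closedBall, dist_comm]; exact hq1)
  have := Metric.infDist_le_dist_of_mem (x := w) hqM
  rw [dist_comm] at this
  linarith

theorem le_noiseEstimator (hne : (boundaryIndices X r).Nonempty) {a : ℝ} (i : Fin n)
    (h : ∀ j ∈ boundaryIndices X r, a ≤ dist (X i) (X j)) : a ≤ noiseEstimator X r := by
  have : Nonempty (boundaryIndices X r) := hne.to_subtype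
  exact le_ciSup_of_le (Set.finite_range _).bddAbove i (le_ciInf fun j => h j j.2)

theorem noiseEstimator_le (hn : 0 < n) {a : ℝ}
    (h : ∀ i, ∀ θ > 0, ∃ j ∈ boundaryIndices X r, dist (X i) (X j) ≤ a + θ) :
    noiseEstimator X r ≤ a := by
  have : Nonempty (Fin n) := ⟨⟨0, hn⟩⟩
  refine ciSup_le fun i => le_of_forall_pos_le_add fun θ hθ => ?_
  obtain ⟨j, hj, hij⟩ := h i θ hθ
  exact ciInf_le_of_le (Set.finite_range _).bddBelow ⟨j, hj⟩ hij

theorem add_sub_le_noiseEstimator (hd : 1 ≤ d) {R ρ : ℝ} (hr : 0 < r) (hrR : r < R)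
    (hcov : ∀ y, Metric.infDist y M ≤ R → y ∈ offset X r)
    (hρ : 0 ≤ ρ) {m : EuclideanSpace ℝ (Fin d)} (hball : Metric.closedBall m ρ ⊆ M) :
    R + ρ - 2 * r ≤ noiseEstimator X r := by
  have hm : m ∈ M := hball (Metric.mem_closedBall_self hρ)
  obtain ⟨i, hi⟩ := Set.mem_iUnion.1
    (hcov m (by rw [Metric.infDist_zero_of_mem hm]; linarith))
  rw [Metric.mem_closedBall] at hi
  have hn : 0 < n := i.pos
  refine le_noiseEstimator (boundaryIndices_nonempty hd hn hr.le) i fun j hj => ?_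
  have h1 := le_infDist_of_mem_boundaryIndices hr hcov hj
  have hjM : X j ∉ M := fun h => by
    rw [Metric.infDist_zero_of_mem h] at h1
    linarith
  have h2 := infDist_add_le_dist hρ hball hjM
  have h3 := dist_triangle m (X i) (X j)
  linarith

theorem noiseEstimator_le_add (hn : 0 < n) (hM : IsCompact M) (hne : M.Nonempty)
    (hint : interior M = ∅) {R R' : ℝ} (hR : 0 < R)
    (hunp : ∀ x, 0 < Metric.infDist x M → Metric.infDist x M < R' → x ∈ unp M)
    (hr : 0 < r) (hrR : R + r < R') (hX : ∀ i, Metric.infDist (X i) M ≤ R) :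
    noiseEstimator X r ≤ R + 2 * r := by
  refine noiseEstimator_le hn fun i θ hθ => ?_
  obtain ⟨z, hz, hzi⟩ := exists_lt_infDist_dist_lt hM hint hunp hne (y := X i)
    (by linarith : 0 < R + r) (by linarith [hX i]) hrR hθ
  have hzo : z ∉ offset X r := by
    intro h
    obtain ⟨k, hk⟩ := Set.mem_iUnion.1 h
    rw [Metric.mem_closedBall] at hk
    have := Metric.infDist_le_infDist_add_dist (s := M) (x := z) (y := X k)
    linarith [hX k]
  obtain ⟨j, hj, hij⟩ := exists_mem_boundaryIndices_dist_le hr.le i hzo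
  rw [dist_comm] at hzi
  exact ⟨j, hj, by linarith⟩

end Offset

/-! ### Lower bounds for the mass of small balls -/

section Volume

variable {d : ℕ}

theorem unitBallVolume_pos (d : ℕ) : 0 < unitBallVolume d :=
  ENNReal.toReal_pos (Metric.measure_closedBall_pos volume _ one_pos).ne'
    measure_closedBall_lt_top.ne

/-- The half ball and its reflection cover the ball. -/
theorem unitBallVolume_le_two_mul_halfBall (v : EuclideanSpace ℝ (Fin d)) :
    unitBallVolume d ≤
      2 * volume.real (Metric.closedBall (0 : EuclideanSpace ℝ (Fin d)) 1 ∩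
        {u | inner ℝ v u ≤ 0}) := by
  set H := Metric.closedBall (0 : EuclideanSpace ℝ (Fin d)) 1 ∩ {u | inner ℝ v u ≤ 0} with hH
  have hfin : volume H ≠ ⊤ :=
    ((measure_mono Set.inter_subset_left).trans_lt measure_closedBall_lt_top).ne
  have hneg : volume.real (-H) = volume.real H := by
    rw [measureReal_def, measureReal_def, Measure.measure_neg]
  have hfin' : volume (-H) ≠ ⊤ := by rwa [Measure.measure_neg]
  have hsub : Metric.closedBall (0 : EuclideanSpace ℝ (Fin d)) 1 ⊆ H ∪ -H := by
    intro u hu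
    rcases le_total (inner ℝ v u) 0 with h | h
    · exact Or.inl ⟨hu, h⟩
    · refine Or.inr ⟨by simpa using hu, ?_⟩
      simpa using h
  calc unitBallVolume d ≤ volume.real (H ∪ -H) :=
        measureReal_mono hsub (measure_union_ne_top hfin hfin')
    _ ≤ volume.real H + volume.real (-H) := measureReal_union_le _ _
    _ = 2 * volume.real H := by rw [hneg]; ring

open scoped Pointwise in
-- The intersection contains a half ball facing `p`, shrunk by `1 - r / R` and shifted towards `p`
-- to absorb the curvature of the large sphere.
theorem half_unitBallVolume_mul_le_volume_inter {y p : EuclideanSpace ℝ (Fin d)} {r R : ℝ}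
    (hr : 0 < r) (hrR : r ≤ R) (hyp : dist y p ≤ R) :
    unitBallVolume d / 2 * ((1 - r / R) * r) ^ d ≤
      volume.real (Metric.closedBall y r ∩ Metric.closedBall p R) := by
  have hR : 0 < R := hr.trans_le hrR
  set v := y - p with hv
  have hvR : ‖v‖ ≤ R := by rwa [hv, ← dist_eq_norm]
  set H := Metric.closedBall (0 : EuclideanSpace ℝ (Fin d)) 1 ∩ {u | inner ℝ v u ≤ 0} with hH
  set t := r / R with ht
  have ht0 : 0 < t := by positivity
  have ht1 : t ≤ 1 := (div_le_one hR).2 hrR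
  have htR : t * R = r := div_mul_cancel₀ _ hR.ne'
  set k := (1 - t) * r with hk
  have hk0 : 0 ≤ k := mul_nonneg (by linarith) hr.le
  have hsub : (y - t ^ 2 • v) +ᵥ (k • H) ⊆ Metric.closedBall y r ∩ Metric.closedBall p R := by
    rintro - ⟨-, ⟨u, ⟨hu1, hu2⟩, rfl⟩, rfl⟩
    rw [mem_closedBall_zero_iff] at hu1
    rw [Set.mem_ofPred_eq] at hu2
    constructor
    · rw [Metric.mem_closedBall, dist_eq_norm]
      have : ((y - t ^ 2 • v) +ᵥ (k • u)) - y = k • u - t ^ 2 • v := by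
        rw [vadd_eq_add]; abel
      change ‖((y - t ^ 2 • v) +ᵥ (k • u)) - y‖ ≤ r
      rw [this]
      calc ‖k • u - t ^ 2 • v‖ ≤ ‖k • u‖ + ‖t ^ 2 • v‖ := norm_sub_le _ _
        _ = k * ‖u‖ + t ^ 2 * ‖v‖ := by
          rw [norm_smul, norm_smul, Real.norm_of_nonneg hk0, Real.norm_of_nonneg (sq_nonneg t)]
        _ ≤ k * 1 + t ^ 2 * R := by gcongr
        _ = r := by rw [hk, ← htR]; ring
    · rw [Metric.mem_closedBall, dist_eq_norm]
      change ‖((y - t ^ 2 • v) +ᵥ (k • u)) - p‖ ≤ R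
      have : ((y - t ^ 2 • v) +ᵥ (k • u)) - p = (1 - t ^ 2) • v + k • u := by
        rw [vadd_eq_add, hv]; module
      rw [this]
      refine abs_le_of_sq_le_sq' ?_ hR.le |>.2
      have ht2 : 0 ≤ 1 - t ^ 2 := by nlinarith
      rw [norm_add_sq_real, real_inner_smul_left, real_inner_smul_right, norm_smul, norm_smul,
        Real.norm_of_nonneg hk0, Real.norm_of_nonneg ht2]
      have h1 : (1 - t ^ 2) * (k * inner ℝ v u) ≤ 0 :=
        mul_nonpos_of_nonneg_of_nonpos ht2 (mul_nonpos_of_nonneg_of_nonpos hk0 hu2)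
      have h2 : ((1 - t ^ 2) * ‖v‖) ^ 2 ≤ ((1 - t ^ 2) * R) ^ 2 := by gcongr
      have h3 : (k * ‖u‖) ^ 2 ≤ (k * 1) ^ 2 := by gcongr
      have h4 : (k * 1) ^ 2 = (1 - t) ^ 2 * t ^ 2 * R ^ 2 := by rw [hk, ← htR]; ring
      have h5 : ((1 - t ^ 2) * R) ^ 2 + (1 - t) ^ 2 * t ^ 2 * R ^ 2 ≤ R ^ 2 := by
        have h6 : (1 - t ^ 2) ^ 2 + (1 - t) ^ 2 * t ^ 2 ≤ 1 := by
          have : 0 ≤ t ^ 2 * (t * (1 - t)) := by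
            have : 0 ≤ 1 - t := by linarith
            positivity
          nlinarith [sq_nonneg t]
        nlinarith [sq_nonneg R]
      linarith
  have hfin : volume (Metric.closedBall y r ∩ Metric.closedBall p R) ≠ ⊤ :=
    ((measure_mono Set.inter_subset_left).trans_lt measure_closedBall_lt_top).ne
  refine le_trans ?_ (measureReal_mono hsub hfin)
  have hvol : volume.real ((y - t ^ 2 • v) +ᵥ (k • H)) = k ^ d * volume.real H := by
    rw [measureReal_def, measure_vadd, Measure.addHaar_smul_of_nonneg _ hk0, ENNReal.toReal_mul,
      finrank_euclideanSpace_fin, ENNReal.toReal_ofReal (by positivity), measureReal_def]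
  rw [hvol]
  have := unitBallVolume_le_two_mul_halfBall v
  have hkd : 0 ≤ k ^ d := by positivity
  nlinarith

theorem half_unitBallVolume_mul_le_measure_closedBall {M : Set (EuclideanSpace ℝ (Fin d))}
    (hM : IsCompact M) (hne : M.Nonempty) {R : ℝ} {P : Measure (EuclideanSpace ℝ (Fin d))}
    [IsFiniteMeasure P] {f : EuclideanSpace ℝ (Fin d) → ℝ≥0∞} (hP : P = volume.withDensity f)
    {f₀ : ℝ} (hf₀ : 0 < f₀)
    (hff₀ : ∀ᵐ x ∂(volume.restrict (Metric.cthickening R M)), ENNReal.ofReal f₀ ≤ f x)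
    {y : EuclideanSpace ℝ (Fin d)} (hy : Metric.infDist y M ≤ R) {r : ℝ} (hr : 0 < r)
    (hrR : r ≤ R) :
    f₀ * unitBallVolume d / 2 * ((1 - r / R) * r) ^ d ≤ P.real (Metric.closedBall y r) := by
  obtain ⟨p, hp, hyp⟩ := hM.exists_infDist_eq_dist hne y
  set A := Metric.closedBall y r ∩ Metric.closedBall p R with hA
  have hAS : A ⊆ Metric.cthickening R M := fun x hx =>
    Metric.mem_cthickening_of_dist_le x p R M hp hx.2
  have hAm : MeasurableSet A := measurableSet_closedBall.inter measurableSet_closedBall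
  have h1 : ENNReal.ofReal f₀ * volume A ≤ P A := by
    rw [hP, withDensity_apply _ hAm, ← setLIntegral_const]
    exact lintegral_mono_ae (ae_restrict_of_ae_restrict_of_subset hAS hff₀)
  have h2 : f₀ * volume.real A ≤ P.real A := by
    have := ENNReal.toReal_mono (measure_ne_top P A) h1
    rwa [ENNReal.toReal_mul, ENNReal.toReal_ofReal hf₀.le] at this
  have h3 := half_unitBallVolume_mul_le_volume_inter hr hrR (hyp ▸ hy)
  calc f₀ * unitBallVolume d / 2 * ((1 - r / R) * r) ^ d
      = f₀ * (unitBallVolume d / 2 * ((1 - r / R) * r) ^ d) := by ring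
    _ ≤ f₀ * volume.real A := by gcongr
    _ ≤ P.real A := h2
    _ ≤ P.real (Metric.closedBall y r) := measureReal_mono Set.inter_subset_left

end Volume

/-! ### Nets and the probability of an uncovered point -/

section Covering

variable {X : Type*} [MetricSpace X] [MeasurableSpace X] [OpensMeasurableSpace X]

theorem card_mul_le_one_of_separated (P : Measure X) [IsProbabilityMeasure P] {s p : ℝ}
    (F : Finset X) (hp : ∀ x ∈ F, p ≤ P.real (Metric.closedBall x (s / 2)))
    (hsep : (F : Set X).Pairwise fun x y => s < dist x y) : F.card * p ≤ 1 := by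
  have hdisj : (F : Set X).PairwiseDisjoint fun x => Metric.closedBall x (s / 2) :=
    fun x hx y hy hxy => Metric.closedBall_disjoint_closedBall (by linarith [hsep hx hy hxy])
  calc (F.card : ℝ) * p = ∑ _x ∈ F, p := by rw [Finset.sum_const, nsmul_eq_mul]
    _ ≤ ∑ x ∈ F, P.real (Metric.closedBall x (s / 2)) := Finset.sum_le_sum hp
    _ = P.real (⋃ x ∈ F, Metric.closedBall x (s / 2)) :=
        (measureReal_biUnion_finset hdisj fun _ _ => measurableSet_closedBall).symm
    _ ≤ 1 := measureReal_le_one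

/-- A separated set of maximal cardinality is a net, and its disjoint half-radius balls each carry
mass at least `p`. -/
theorem exists_finset_cover_card_mul_le_one (P : Measure X) [IsProbabilityMeasure P] {S : Set X}
    {s p : ℝ} (hs : 0 ≤ s) (hp0 : 0 < p)
    (hp : ∀ x ∈ S, p ≤ P.real (Metric.closedBall x (s / 2))) :
    ∃ F : Finset X, (F : Set X) ⊆ S ∧ (∀ x ∈ S, ∃ y ∈ F, dist x y ≤ s) ∧ F.card * p ≤ 1 := by
  classical
  set C : Set ℕ := {k | ∃ F : Finset X, (F : Set X) ⊆ S ∧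
    (F : Set X).Pairwise (fun x y => s < dist x y) ∧ F.card = k} with hC
  have hbdd : BddAbove C := by
    refine ⟨⌈1 / p⌉₊, ?_⟩
    rintro - ⟨F, hFS, hsep, rfl⟩
    have h1 := card_mul_le_one_of_separated P F (fun x hx => hp x (hFS hx)) hsep
    have h2 : (F.card : ℝ) ≤ 1 / p := (le_div_iff₀ hp0).2 h1
    exact_mod_cast h2.trans (Nat.le_ceil _)
  have hne : C.Nonempty := ⟨0, ∅, by simp, by simp, rfl⟩
  obtain ⟨F, hFS, hsep, hcard⟩ := Nat.sSup_mem hne hbdd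
  refine ⟨F, hFS, fun x hx => ?_, card_mul_le_one_of_separated P F (fun x hx => hp x (hFS hx)) hsep⟩
  by_contra! hcon
  have hxF : x ∉ F := fun h => by
    have := hcon x h
    rw [dist_self] at this
    linarith
  have hmem : F.card + 1 ∈ C := by
    refine ⟨insert x F, ?_, ?_, Finset.card_insert_of_notMem hxF⟩
    · rw [Finset.coe_insert]
      exact Set.insert_subset hx hFS
    · rw [Finset.coe_insert]
      exact hsep.insert fun y hy _ => ⟨hcon y hy, dist_comm x y ▸ hcon y hy⟩
  have := le_csSup hbdd hmem
  omega

theorem measure_forall_notMem_closedBall_le {Ω : Type*} [MeasurableSpace Ω] {μ : Measure Ω}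
    [IsProbabilityMeasure μ] {Y : ℕ → Ω → X} (hYmeas : ∀ i, Measurable (Y i))
    (hYindep : iIndepFun Y μ) {P : Measure X} (hYlaw : ∀ i, μ.map (Y i) = P) (n : ℕ) (x : X)
    (r : ℝ) {q : ℝ} (hq : q ≤ P.real (Metric.closedBall x r)) :
    μ {ω | ∀ i < n, Y i ω ∉ Metric.closedBall x r} ≤ ENNReal.ofReal (Real.exp (-(n * q))) := by
  have : IsProbabilityMeasure P := hYlaw 0 ▸ Measure.isProbabilityMeasure_map (hYmeas 0).aemeasurable
  have hset : {ω | ∀ i < n, Y i ω ∉ Metric.closedBall x r} =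
      ⋂ i ∈ Finset.range n, Y i ⁻¹' (Metric.closedBall x r)ᶜ := by
    ext ω
    simp
  have hcompl : P (Metric.closedBall x r)ᶜ ≤ ENNReal.ofReal (Real.exp (-q)) := by
    rw [← ofReal_measureReal, probReal_compl_eq_one_sub measurableSet_closedBall]
    refine ENNReal.ofReal_le_ofReal ?_
    linarith [Real.add_one_le_exp (-q)]
  rw [hset, hYindep.meas_biInter fun i _ =>
    ⟨_, measurableSet_closedBall.compl, rfl⟩]
  calc ∏ i ∈ Finset.range n, μ (Y i ⁻¹' (Metric.closedBall x r)ᶜ)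
      = ∏ _i ∈ Finset.range n, P (Metric.closedBall x r)ᶜ := by
        refine Finset.prod_congr rfl fun i _ => ?_
        rw [← hYlaw i, Measure.map_apply (hYmeas i) measurableSet_closedBall.compl]
    _ ≤ ∏ _i ∈ Finset.range n, ENNReal.ofReal (Real.exp (-q)) :=
        Finset.prod_le_prod' fun _ _ => hcompl
    _ = ENNReal.ofReal (Real.exp (-(n * q))) := by
        rw [Finset.prod_const, Finset.card_range, ← ENNReal.ofReal_pow (Real.exp_pos _).le,
          ← Real.exp_nat_mul]
        ring_nf

/-- A point of `S` farther than `r + s` from the sample forces an empty `r`-ball around some net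
point; the union bound runs over at most `p⁻¹` centres. -/
theorem measure_exists_forall_lt_dist_le {Ω : Type*} [MeasurableSpace Ω] {μ : Measure Ω}
    [IsProbabilityMeasure μ] {Y : ℕ → Ω → X} (hYmeas : ∀ i, Measurable (Y i))
    (hYindep : iIndepFun Y μ) {P : Measure X} (hYlaw : ∀ i, μ.map (Y i) = P) (n : ℕ)
    {S : Set X} {r s p q : ℝ} (hs : 0 ≤ s) (hp0 : 0 < p)
    (hp : ∀ x ∈ S, p ≤ P.real (Metric.closedBall x (s / 2)))
    (hq : ∀ x ∈ S, q ≤ P.real (Metric.closedBall x r)) :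
    μ {ω | ∃ x ∈ S, ∀ i < n, r + s < dist x (Y i ω)} ≤
      ENNReal.ofReal (p⁻¹ * Real.exp (-(n * q))) := by
  have : IsProbabilityMeasure P := hYlaw 0 ▸ Measure.isProbabilityMeasure_map (hYmeas 0).aemeasurable
  obtain ⟨F, hFS, hcov, hcard⟩ := exists_finset_cover_card_mul_le_one P hs hp0 hp
  have hsub : {ω | ∃ x ∈ S, ∀ i < n, r + s < dist x (Y i ω)} ⊆
      ⋃ y ∈ F, {ω | ∀ i < n, Y i ω ∉ Metric.closedBall y r} := by
    rintro ω ⟨x, hx, hω⟩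
    obtain ⟨y, hy, hxy⟩ := hcov x hx
    simp only [Set.mem_iUnion]
    refine ⟨y, hy, fun i hi hmem => ?_⟩
    rw [Metric.mem_closedBall, dist_comm] at hmem
    linarith [hω i hi, dist_triangle x y (Y i ω)]
  calc μ _ ≤ μ (⋃ y ∈ F, {ω | ∀ i < n, Y i ω ∉ Metric.closedBall y r}) := measure_mono hsub
    _ ≤ ∑ y ∈ F, μ {ω | ∀ i < n, Y i ω ∉ Metric.closedBall y r} := measure_biUnion_finset_le _ _
    _ ≤ ∑ _y ∈ F, ENNReal.ofReal (Real.exp (-(n * q))) := Finset.sum_le_sum fun y hy =>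
        measure_forall_notMem_closedBall_le hYmeas hYindep hYlaw n y r (hq y (hFS hy))
    _ = ENNReal.ofReal (F.card * Real.exp (-(n * q))) := by
        rw [Finset.sum_const, nsmul_eq_mul, ENNReal.ofReal_mul (by positivity),
          ENNReal.ofReal_natCast]
    _ ≤ ENNReal.ofReal (p⁻¹ * Real.exp (-(n * q))) := by
        refine ENNReal.ofReal_le_ofReal (mul_le_mul_of_nonneg_right ?_ (Real.exp_pos _).le)
        rw [← one_div, le_div_iff₀ hp0]
        exact hcard

end Covering

/-! ### Asymptotics of the radius -/

section Radius

variable {d : ℕ}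

theorem radius_pos (d : ℕ) {c : ℝ} (hc : 0 < c) {n : ℕ} (hn : 2 ≤ n) : 0 < radius d c n := by
  have h1 : (1 : ℝ) < n := by exact_mod_cast hn
  have h2 : 0 < Real.log n := Real.log_pos h1
  unfold radius
  positivity

theorem radius_pow (hd : 1 ≤ d) (c : ℝ) (n : ℕ) :
    radius d c n ^ d = c ^ d * (Real.log n / n) := by
  have h : 0 ≤ Real.log n / n := div_nonneg (Real.log_natCast_nonneg n) (Nat.cast_nonneg n)
  rw [radius, mul_pow, one_div, Real.rpow_inv_natCast_pow h (by omega)]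

theorem tendsto_radius (hd : 1 ≤ d) (c : ℝ) : Tendsto (radius d c) atTop (𝓝 0) := by
  have h1 : Tendsto (fun n : ℕ => Real.log n / n) atTop (𝓝 0) :=
    Real.isLittleO_log_id_atTop.tendsto_div_nhds_zero.comp tendsto_natCast_atTop_atTop
  have hd' : (0 : ℝ) < 1 / (d : ℝ) := by positivity
  have h2 := (h1.rpow_const (p := 1 / (d : ℝ)) (Or.inr hd'.le)).const_mul c
  rwa [Real.zero_rpow hd'.ne', mul_zero] at h2

theorem mul_lt_mul_pow_of_div_rpow_lt (hd : 1 ≤ d) {a b c : ℝ} (ha : 0 ≤ a) (hb : 0 < b)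
    (hc : (a / b) ^ (1 / (d : ℝ)) < c) : a < b * c ^ d := by
  have h := pow_lt_pow_left₀ hc (by positivity) (n := d) (by omega)
  rw [one_div, Real.rpow_inv_natCast_pow (by positivity) (by omega), div_lt_iff₀ hb] at h
  linarith

end Radius

/-! ### Almost sure eventual coverage -/

section Coverage

variable {d : ℕ} {Ω : Type*} [MeasurableSpace Ω] {μ : Measure Ω} [IsProbabilityMeasure μ]
  {Y : ℕ → Ω → EuclideanSpace ℝ (Fin d)} {P : Measure (EuclideanSpace ℝ (Fin d))}

theorem ae_eventually_subset_offset (hd : 1 ≤ d) (hYmeas : ∀ i, Measurable (Y i))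
    (hYindep : iIndepFun Y μ) (hYlaw : ∀ i, μ.map (Y i) = P)
    {S : Set (EuclideanSpace ℝ (Fin d))} {a R c : ℝ} (ha : 0 < a) (hR : 0 < R) (hc : 0 < c)
    (hball : ∀ x ∈ S, ∀ r, 0 < r → r ≤ R →
      a / 2 * ((1 - r / R) * r) ^ d ≤ P.real (Metric.closedBall x r))
    (hac : 6 < a * c ^ d) :
    ∀ᵐ ω ∂μ, ∀ᶠ n : ℕ in atTop, S ⊆ offset (fun i : Fin n => Y i ω) (radius d c n) := by
  have hd' : (1 : ℝ) ≤ d := by exact_mod_cast hd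
  -- By Bernoulli `(1 - η) ^ (2 * d) ≥ 5 / 6`, so `a * c ^ d / 2 > 3` still leaves exponent `5 / 2`.
  -- The net has `O(n / log n)` points, whence the summable `n ^ (-3 / 2)`.
  set η : ℝ := 1 / (12 * d) with hη
  have hη0 : 0 < η := by positivity
  have hη1 : η ≤ 1 / 12 := by
    rw [hη]
    gcongr
    linarith
  have hηpow : 5 / 6 ≤ ((1 - η) * (1 - η)) ^ d := by
    have h := one_add_mul_le_pow (a := -η) (by linarith) (2 * d)
    rw [pow_mul] at h
    have h2 : (1 + ((2 * d : ℕ) : ℝ) * -η) = 5 / 6 := by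
      rw [hη]; push_cast; field_simp; norm_num
    rw [h2] at h
    calc (5 / 6 : ℝ) ≤ ((1 + -η) ^ 2) ^ d := h
      _ = ((1 - η) * (1 - η)) ^ d := by ring
  set κ : ℝ := a / 2 * ((1 - η) * (η / 2) * c) ^ d with hκ
  have h1η : 0 < 1 - η := by linarith
  have hκ0 : 0 < κ := by positivity
  have hev : ∀ᶠ n : ℕ in atTop, 3 ≤ n ∧ radius d c n ≤ η * R :=
    (eventually_ge_atTop 3).and ((tendsto_radius hd c).eventually_le_const (by positivity))
  obtain ⟨N, hN⟩ := eventually_atTop.1 hev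
  -- Including `N ≤ n` in the event makes the bound hold for every `n`.
  set A : ℕ → Set Ω := fun n => {ω | N ≤ n ∧ ∃ x ∈ S, ∀ i < n, radius d c n < dist x (Y i ω)}
    with hA
  have hbound : ∀ n, μ (A n) ≤ ENNReal.ofReal (κ⁻¹ * (n : ℝ) ^ (-(3 / 2) : ℝ)) := by
    intro n
    by_cases hNn : N ≤ n
    swap
    · simp [hA, hNn]
    obtain ⟨hn3, hnR⟩ := hN n hNn
    have hn0 : (0 : ℝ) < n := by positivity
    set ε := radius d c n with hε
    have hε0 : 0 < ε := radius_pos d hc (by omega)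
    have hlog : 1 ≤ Real.log n := by
      rw [Real.le_log_iff_exp_le hn0]
      have h3 : (3 : ℝ) ≤ n := by exact_mod_cast hn3
      linarith [Real.exp_one_lt_d9]
    have hball' : ∀ x ∈ S, ∀ r, 0 < r → r ≤ ε →
        a / 2 * ((1 - η) * r) ^ d ≤ P.real (Metric.closedBall x r) := by
      intro x hx r hr hrε
      have hrR : r ≤ η * R := hrε.trans hnR
      refine le_trans ?_ (hball x hx r hr (by nlinarith))
      have : r / R ≤ η := (div_le_iff₀ hR).2 hrR
      gcongr
    have hp : ∀ x ∈ S, κ * (Real.log n / n) ≤ P.real (Metric.closedBall x (η * ε / 2)) := by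
      intro x hx
      refine le_of_eq_of_le ?_ (hball' x hx (η * ε / 2) (by positivity) (by nlinarith))
      have : (1 - η) * (η * ε / 2) = (1 - η) * (η / 2) * ε := by ring
      rw [this, mul_pow _ ε, hε, radius_pow hd, hκ, mul_pow _ c]
      ring
    have hq : ∀ x ∈ S, 5 / 2 * (Real.log n / n) ≤
        P.real (Metric.closedBall x ((1 - η) * ε)) := by
      intro x hx
      refine le_trans ?_ (hball' x hx ((1 - η) * ε) (by positivity) (by nlinarith))
      rw [← mul_assoc, mul_pow _ ε, hε, radius_pow hd]
      have h1 : 5 / 2 ≤ a / 2 * (((1 - η) * (1 - η)) ^ d) * c ^ d := by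
        have h2 : 5 / 6 * (a * c ^ d) ≤ ((1 - η) * (1 - η)) ^ d * (a * c ^ d) := by gcongr
        nlinarith
      have hL : 0 ≤ Real.log n / n := by positivity
      calc 5 / 2 * (Real.log n / n)
          ≤ (a / 2 * (((1 - η) * (1 - η)) ^ d) * c ^ d) * (Real.log n / n) := by gcongr
        _ = a / 2 * (((1 - η) * (1 - η)) ^ d * (c ^ d * (Real.log n / n))) := by ring
    have hlogn : 0 < Real.log n / n := by positivity
    have hmain := measure_exists_forall_lt_dist_le hYmeas hYindep hYlaw n (S := S)
      (r := (1 - η) * ε) (s := η * ε) (by positivity) (mul_pos hκ0 hlogn) hp hq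
    refine (measure_mono ?_).trans (hmain.trans (ENNReal.ofReal_le_ofReal ?_))
    · rintro ω ⟨-, x, hx, hω⟩
      refine ⟨x, hx, fun i hi => ?_⟩
      have : (1 - η) * ε + η * ε = ε := by ring
      rw [this]
      exact hω i hi
    · have h1 : Real.exp (-(n * (5 / 2 * (Real.log n / n)))) = (n : ℝ) ^ (-(5 / 2) : ℝ) := by
        rw [Real.rpow_def_of_pos hn0]
        congr 1
        field_simp
      have h2 : (n : ℝ) ^ (-(3 / 2) : ℝ) = n * (n : ℝ) ^ (-(5 / 2) : ℝ) := by
        rw [mul_comm, ← Real.rpow_add_one hn0.ne']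
        norm_num
      rw [h1, h2, mul_inv, inv_div, mul_assoc]
      gcongr
      exact div_le_self hn0.le hlog
  have hsum : (∑' n, μ (A n)) ≠ ⊤ := by
    have hs : Summable fun n : ℕ => κ⁻¹ * (n : ℝ) ^ (-(3 / 2) : ℝ) :=
      (Real.summable_nat_rpow.2 (by norm_num)).mul_left _
    exact ne_top_of_le_ne_top hs.tsum_ofReal_ne_top (ENNReal.tsum_le_tsum hbound)
  filter_upwards [ae_eventually_notMem hsum] with ω hω
  filter_upwards [hω, eventually_ge_atTop N] with n hn hNn x hx
  by_contra hcon
  refine hn ⟨hNn, x, hx, fun i hi => not_le.1 fun hle => hcon ?_⟩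
  exact Set.mem_iUnion.2 ⟨⟨i, hi⟩, hle⟩

end Coverage

end ParallelModel

/-! ### The main theorem -/

theorem theorem3 {d : ℕ} (hd : 1 ≤ d)
    (M : Set (EuclideanSpace ℝ (Fin d))) (hM : IsCompact M)
    (R₀ : ℝ≥0∞) (hreach : ParallelModel.reach M = R₀) (hR₀ : 0 < R₀)
    (R₁ : ℝ) (hR₁ : 0 < R₁) (hR₁₀ : ENNReal.ofReal R₁ < R₀)
    {Ω : Type*} [MeasurableSpace Ω] (μ : Measure Ω) [IsProbabilityMeasure μ]
    (Y : ℕ → Ω → EuclideanSpace ℝ (Fin d)) (hYmeas : ∀ i, Measurable (Y i))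
    (hYindep : iIndepFun Y μ)
    (PY : Measure (EuclideanSpace ℝ (Fin d))) (hYlaw : ∀ i, μ.map (Y i) = PY)
    (hsupp : PY.support = Metric.cthickening R₁ M)
    (f : EuclideanSpace ℝ (Fin d) → ℝ≥0∞) (hfmeas : Measurable f)
    (hf : PY = volume.withDensity f)
    (f₀ : ℝ) (hf₀ : 0 < f₀)
    (hff₀ : ∀ᵐ x ∂(volume.restrict (Metric.cthickening R₁ M)), ENNReal.ofReal f₀ ≤ f x)
    (c : ℝ) (hc : (6 / (f₀ * ParallelModel.unitBallVolume d)) ^ (1 / (d : ℝ)) < c) :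
    (interior M = ∅ →
      ∀ᵐ ω ∂μ, ∀ᶠ n : ℕ in atTop,
        |ParallelModel.noiseEstimator (fun i : Fin n => Y i ω) (ParallelModel.radius d c n) - R₁|
          ≤ 2 * ParallelModel.radius d c n) ∧
    ((interior M).Nonempty →
      ∃ C : ℝ, 0 < C ∧ ∀ᵐ ω ∂μ, ∀ᶠ n : ℕ in atTop,
        C < |ParallelModel.noiseEstimator (fun i : Fin n => Y i ω)
              (ParallelModel.radius d c n) - R₁|) := by
  have hprob : IsProbabilityMeasure PY :=
    hYlaw 0 ▸ Measure.isProbabilityMeasure_map (hYmeas 0).aemeasurable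
  have hne : M.Nonempty := by
    by_contra h
    rw [Set.not_nonempty_iff_eq_empty.1 h, Metric.cthickening_empty,
      Measure.support_eq_empty_iff] at hsupp
    exact IsProbabilityMeasure.ne_zero PY hsupp
  have hω := ParallelModel.unitBallVolume_pos d
  have hc0 : 0 < c := lt_of_le_of_lt (by positivity) hc
  have hrad := ParallelModel.tendsto_radius hd c
  have hcov := ParallelModel.ae_eventually_subset_offset hd hYmeas hYindep hYlaw
    (S := {y | Metric.infDist y M ≤ R₁}) (mul_pos hf₀ hω) hR₁ hc0
    (fun x hx r hr hrR => ParallelModel.half_unitBallVolume_mul_le_measure_closedBall hM hne hf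
      hf₀ hff₀ hx hr hrR)
    (ParallelModel.mul_lt_mul_pow_of_div_rpow_lt hd (by norm_num) (mul_pos hf₀ hω) hc)
  have hmem : ∀ᵐ ω ∂μ, ∀ i, Metric.infDist (Y i ω) M ≤ R₁ := by
    refine ae_all_iff.2 fun i => ?_
    have h1 : ∀ᵐ x ∂μ.map (Y i), x ∈ PY.support := hYlaw i ▸ Measure.support_mem_ae
    filter_upwards [ae_of_ae_map (hYmeas i).aemeasurable h1] with ω h
    rw [hsupp] at h
    exact (ParallelModel.mem_cthickening_iff_infDist_le hne hR₁.le).1 h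
  constructor
  · intro hint
    -- A finite level strictly between `R₁` and the possibly infinite reach leaves room to climb
    -- past `R₁ + r`.
    obtain ⟨R', hR', hR'₀⟩ := ENNReal.lt_iff_exists_real_btwn.1 hR₁₀ |>.imp fun R h => h.2
    have hlt : R₁ < R' := (ENNReal.ofReal_lt_ofReal_iff_of_nonneg hR₁.le).1 hR'
    have hunp : ∀ x, 0 < Metric.infDist x M → Metric.infDist x M < R' →
        x ∈ ParallelModel.unp M := fun x _ hx =>
      ParallelModel.mem_unp_of_infDist_lt_reach hM hne
        (hreach ▸ (ENNReal.ofReal_le_ofReal hx.le).trans_lt hR'₀)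
    filter_upwards [hcov, hmem] with ω h1 h2
    filter_upwards [h1, eventually_ge_atTop 2, hrad.eventually_lt_const hR₁,
      hrad.eventually_lt_const (sub_pos.2 hlt)] with n hS hn hn1 hn2
    have hr := ParallelModel.radius_pos d hc0 hn
    obtain ⟨m, hm⟩ := hne
    have hlow := ParallelModel.add_sub_le_noiseEstimator hd hr hn1 hS le_rfl
      (m := m) (M := M) (by simpa using hm)
    have hup := ParallelModel.noiseEstimator_le_add (X := fun i : Fin n => Y i ω) (by omega) hM
      ⟨m, hm⟩ hint hR₁ hunp hr (by linarith) (fun i => h2 i)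
    exact abs_le.2 ⟨by linarith, by linarith⟩
  · rintro ⟨m, hm⟩
    obtain ⟨ρ, hρ, hball⟩ := Metric.nhds_basis_closedBall.mem_iff.1 (mem_interior_iff_mem_nhds.1 hm)
    -- The excess is at least `ρ - 2r`, which is above `ρ / 2` once `r < ρ / 4`.
    refine ⟨ρ / 2, by positivity, ?_⟩
    filter_upwards [hcov] with ω h1
    filter_upwards [h1, eventually_ge_atTop 2, hrad.eventually_lt_const hR₁,
      hrad.eventually_lt_const (by positivity : 0 < ρ / 4)] with n hS hn hn1 hn2
    have hlow := ParallelModel.add_sub_le_noiseEstimator hd (ParallelModel.radius_pos d hc0 hn) hn1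
      hS hρ.le hball
    exact lt_of_lt_of_le (by linarith) (le_abs_self _)
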